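/- A \emph{lattice equable parallelogram} (LEP) is a nondegenerate parallelogram in the Euclidean plane $\mathbb{R}^2$ whose vertices lie in $\mathbb{Z}^2$ and whose perimeter equals its area. The \emph{first quadrant} is the closed set $\{(x,y)\in\mathbb{R}^2 : x\ge 0,\ y\ge 0\}$. (i) Let $P$ be a LEP with vertices $O,A,B,C$ in cyclic order, where $O=(0,0)$ is the origin. Suppose that $OB$ is a long diagonal of $P$, that is, $|OB|\ge |AC|$, and that the segment $OB$ is contained in the first quadrant. Then all four vertices $O,A,B,C$ lie in the first quadrant. (ii) For every LEP $P$ there is a Euclidean motion (isometry) $g$ of $\mathbb{R}^2$ such that $g(P)$ is again a LEP, is contained in the first quadrant, and has a vertex at the origin. -/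

import Mathlib

open MeasureTheory

noncomputable section

/-- The Euclidean plane. -/
abbrev Plane : Type := EuclideanSpace ℝ (Fin 2)

/-- The filled quadrilateral region spanned by four points. -/
def region (P : Fin 4 → Plane) : Set Plane :=
  convexHull ℝ (Set.range P)

/-- The perimeter of the quadrilateral with vertices `P 0, P 1, P 2, P 3` in cyclic order. -/
def perimeter (P : Fin 4 → Plane) : ℝ :=
  dist (P 0) (P 1) + dist (P 1) (P 2) + dist (P 2) (P 3) + dist (P 3) (P 0)

/-- The area (two-dimensional Lebesgue measure) of the quadrilateral region. -/
def area (P : Fin 4 → Plane) : ℝ :=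
  volume.real (region P)

/-- `P 0, P 1, P 2, P 3` are, in cyclic order (of either orientation), the vertices of a
nondegenerate parallelogram. -/
def IsParallelogram (P : Fin 4 → Plane) : Prop :=
  AffineIndependent ℝ ![P 0, P 1, P 2] ∧ P 1 - P 0 = P 2 - P 3

/-- The point has integer coordinates. -/
def IsLatticePoint (p : Plane) : Prop :=
  ∀ j, ∃ n : ℤ, p j = n

/-- Lattice equable parallelogram, given by its vertices in cyclic order. -/
structure IsLEP (P : Fin 4 → Plane) : Prop where
  parallelogram : IsParallelogram P
  lattice : ∀ i, IsLatticePoint (P i)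
  equable : perimeter P = area P

/-- The closed first quadrant. -/
def firstQuadrant : Set Plane :=
  {p | 0 ≤ p 0 ∧ 0 ≤ p 1}

end

/-!
Let `u` and `v` be the edges of the parallelogram at a vertex. The perimeter `2 (|u| + |v|)` equals
the area `|u₀ v₁ - u₁ v₀|`, an integer, and `|u|²`, `|v|²` are integers as well, so `|u|` and `|v|`
are rational, hence integral. When no coordinate vanishes, `u` and `v` are therefore hypotenuses of
integral right triangles. By parity the legs of such a triangle exceed the hypotenuse by at least
`2` in total, and each leg is at least `3`; this gives
`|u₀| |v₁| + |u₁| |v₀| > 2 (|u₀| + |u₁| + |v₀| + |v₁|) - 8 ≥ 2 (|u| + |v|)`. Hence `u₀ v₁` and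
`u₁ v₀` cannot have opposite signs, that is, `(u₀ v₀) (u₁ v₁) ≥ 0`. If `u + v` is a long diagonal,
then `u₀ v₀ + u₁ v₁ ≥ 0`, so both products are nonnegative, and each coordinate of `u` and of `v`
has the sign of the corresponding coordinate of `u + v`. For the second part, move an endpoint of a
long diagonal to the origin and reflect in the axes.
-/

lemma mem_of_add_mem_of_sq_sub_sq_mem {K : Type*} [Field K] [NeZero (2 : K)] (S : Subfield K)
    {x y : K} (hne : x + y ≠ 0) (hadd : x + y ∈ S) (hsq : x ^ 2 - y ^ 2 ∈ S) : x ∈ S := by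
  have hx : x = ((x + y) + (x ^ 2 - y ^ 2) / (x + y)) / 2 := by
    field_simp
    ring
  rw [hx]
  exact div_mem (add_mem hadd (div_mem hsq hadd)) (ofNat_mem S 2)

lemma nonneg_of_mul_nonneg_of_add_nonneg {R : Type*} [Ring R] [LinearOrder R]
    [IsStrictOrderedRing R] {x y : R} (hmul : 0 ≤ x * y) (hadd : 0 ≤ x + y) : 0 ≤ x := by
  by_contra! hx
  have hy : 0 < y := (neg_pos.2 hx).trans_le (neg_le_iff_add_nonneg'.2 hadd)
  exact hmul.not_gt (mul_neg_of_neg_of_pos hx hy)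

lemma abs_sub_eq_abs_add_abs_of_mul_nonpos {R : Type*} [Ring R] [LinearOrder R]
    [IsStrictOrderedRing R] {x y : R} (h : x * y ≤ 0) : |x - y| = |x| + |y| := by
  rw [sub_eq_add_neg, ← abs_neg y, abs_add_eq_add_abs_iff]
  simpa only [neg_nonneg, neg_nonpos] using mul_nonpos_iff.1 h

lemma inner_nonneg_iff_norm_sub_le_norm_add {E : Type*} [NormedAddCommGroup E]
    [InnerProductSpace ℝ E] {u v : E} : 0 ≤ inner ℝ u v ↔ ‖u - v‖ ≤ ‖u + v‖ := by
  rw [← sq_le_sq₀ (norm_nonneg _) (norm_nonneg _), norm_sub_sq_real, norm_add_sq_real]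
  constructor <;> intro h <;> linarith

open scoped Pointwise in
lemma convexHull_eq_parallelepiped {E : Type*} [AddCommGroup E] [Module ℝ E] (u v : E) :
    convexHull ℝ {0, u, u + v, v} = parallelepiped ![u, v] := by
  rw [parallelepiped_eq_convexHull, Fin.sum_univ_two]
  congr 1
  simp only [Matrix.cons_val_zero, Matrix.cons_val_one, Set.insert_eq 0 {u}, Set.union_add,
    Set.singleton_add, Set.image_pair, zero_add, add_zero]
  grind

lemma volume_image_isometry {n : ℕ} {f : EuclideanSpace ℝ (Fin n) → EuclideanSpace ℝ (Fin n)}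
    (hf : Isometry f) (s : Set (EuclideanSpace ℝ (Fin n))) : volume (f '' s) = volume s := by
  rw [← EuclideanSpace.euclideanHausdorffMeasure_eq_volume, hf.euclideanHausdorffMeasure_image]

lemma exists_linearIsometryEquiv_apply_eq_abs {ι : Type*} [Fintype ι] (w : EuclideanSpace ℝ ι) :
    ∃ e : EuclideanSpace ℝ ι ≃ₗᵢ[ℝ] EuclideanSpace ℝ ι,
      (∀ j, e w j = |w j|) ∧ ∀ x j, |e x j| = |x j| := by
  refine ⟨.piLpCongrRight 2 fun j => if 0 ≤ w j then .refl ℝ ℝ else .neg ℝ,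
    fun j => ?_, fun x j => ?_⟩
  · by_cases hj : 0 ≤ w j
    · simp [hj, abs_of_nonneg]
    · simp [hj, abs_of_neg (not_le.1 hj)]
  · by_cases hj : 0 ≤ w j <;> simp [hj]

section RightTriangle

variable {a b m : ℤ}

lemma abs_hypotenuse_add_two_le_add_legs (h : PythagoreanTriple a b m) (ha : 0 < a) (hb : 0 < b) :
    |m| + 2 ≤ a + b := by
  have hlt : |m| < a + b := by
    rw [← abs_of_pos (add_pos ha hb), ← sq_lt_sq]
    nlinarith [h.eq, mul_pos ha hb]
  have hparity : Even (a + b + |m|) := by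
    have hsum : Even (a * a + b * b + m * m) := ⟨m * m, by rw [h.eq]⟩
    simpa only [Int.even_add, Int.even_mul, or_self, even_abs] using hsum
  obtain ⟨k, hk⟩ := hparity
  lia

lemma two_lt_leg_of_pythagoreanTriple (h : PythagoreanTriple a b m) (ha : 0 < a) (hb : 0 < b) :
    2 < a := by
  have hsq : m ^ 2 ≤ (a + b - 2) ^ 2 := by
    have hle := abs_hypotenuse_add_two_le_add_legs h ha hb
    exact sq_le_sq' (by grind) (by grind)
  have hprod : 2 ≤ (a - 2) * (b - 2) := by linarith [h.eq]
  -- Both factors are at least `-1`, so `a ≤ 2` would make their product at most `1`.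
  by_contra! hle
  nlinarith

lemma two_mul_abs_hypotenuses_lt {c d n : ℤ} (habm : PythagoreanTriple a b m)
    (hcdn : PythagoreanTriple c d n) (ha : 0 < a) (hb : 0 < b) (hc : 0 < c) (hd : 0 < d) :
    2 * (|m| + |n|) < a * d + b * c := by
  have ha2 := two_lt_leg_of_pythagoreanTriple habm ha hb
  have hb2 := two_lt_leg_of_pythagoreanTriple habm.symm hb ha
  have hc2 := two_lt_leg_of_pythagoreanTriple hcdn hc hd
  have hd2 := two_lt_leg_of_pythagoreanTriple hcdn.symm hd hc
  calc
    2 * (|m| + |n|) ≤ 2 * (a + b - 2 + (c + d - 2)) := by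
      linarith [abs_hypotenuse_add_two_le_add_legs habm ha hb,
        abs_hypotenuse_add_two_le_add_legs hcdn hc hd]
    _ < 2 * (a + b - 2 + (c + d - 2)) + ((a - 2) * (d - 2) + (b - 2) * (c - 2)) :=
      lt_add_of_pos_right _ (add_pos (mul_pos (sub_pos.2 ha2) (sub_pos.2 hd2))
        (mul_pos (sub_pos.2 hb2) (sub_pos.2 hc2)))
    _ = a * d + b * c := by ring

end RightTriangle

/-- The planar cross product: the signed area of the parallelogram spanned by `u` and `v`. -/
def cross (u v : Plane) : ℝ :=
  u 0 * v 1 - u 1 * v 0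

/-- `u` and `v` are the edge vectors, at one vertex, of a lattice parallelogram whose perimeter
equals its area. The degenerate pair `u = v = 0` is allowed. -/
structure IsEquablePair (u v : Plane) : Prop where
  lattice_left : IsLatticePoint u
  lattice_right : IsLatticePoint v
  equable : 2 * (‖u‖ + ‖v‖) = |cross u v|

/-- `f` maps the integer lattice into itself. -/
def PreservesLattice (f : Plane → Plane) : Prop :=
  ∀ ⦃p⦄, IsLatticePoint p → IsLatticePoint (f p)

lemma mem_firstQuadrant_iff {p : Plane} : p ∈ firstQuadrant ↔ ∀ j, 0 ≤ p j :=
  Fin.forall_fin_two (p := fun j => 0 ≤ p j).symm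

lemma convex_firstQuadrant : Convex ℝ firstQuadrant := by
  rintro x ⟨hx0, hx1⟩ y ⟨hy0, hy1⟩ a b ha hb -
  constructor <;> simp only [PiLp.add_apply, PiLp.smul_apply, smul_eq_mul] <;> positivity

namespace IsLatticePoint

variable {p q : Plane}

lemma sub (hp : IsLatticePoint p) (hq : IsLatticePoint q) : IsLatticePoint (p - q) := fun j => by
  obtain ⟨m, hm⟩ := hp j
  obtain ⟨n, hn⟩ := hq j
  exact ⟨m - n, by simp [hm, hn]⟩

lemma of_abs_eq (hp : IsLatticePoint p) (h : ∀ j, |q j| = |p j|) : IsLatticePoint q := fun j => by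
  obtain ⟨m, hm⟩ := hp j
  rcases abs_eq_abs.1 (h j) with hj | hj
  · exact ⟨m, hj.trans hm⟩
  · exact ⟨-m, by simp [hj, hm]⟩

end IsLatticePoint

namespace IsEquablePair

variable {u v : Plane}

lemma symm (h : IsEquablePair u v) : IsEquablePair v u where
  lattice_left := h.lattice_right
  lattice_right := h.lattice_left
  equable := by
    rw [add_comm, h.equable, ← abs_neg]
    congr 1
    simp only [cross]
    ring

lemma exists_int_norm_eq (h : IsEquablePair u v) : ∃ m : ℤ, ‖u‖ = m := by
  rcases eq_or_ne u 0 with rfl | hu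
  · exact ⟨0, by simp⟩
  choose a ha using h.lattice_left
  choose b hb using h.lattice_right
  let S : Subfield ℝ := (Rat.castHom ℝ).fieldRange
  have hadd : ‖u‖ + ‖v‖ ∈ S := by
    have hcross : ‖u‖ + ‖v‖ = (|a 0 * b 1 - a 1 * b 0| : ℤ) / 2 := by
      rw [eq_div_iff two_ne_zero, mul_comm, h.equable, cross, ha, ha, hb, hb]
      push_cast
      rfl
    rw [hcross]
    exact div_mem (intCast_mem S _) (ofNat_mem S 2)
  have hu_sq : ‖u‖ ^ 2 = (a 0 ^ 2 + a 1 ^ 2 : ℤ) := by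
    simp [EuclideanSpace.real_norm_sq_eq, ha]
  have hv_sq : ‖v‖ ^ 2 = (b 0 ^ 2 + b 1 ^ 2 : ℤ) := by
    simp [EuclideanSpace.real_norm_sq_eq, hb]
  have hrat : ‖u‖ ∈ S := by
    refine mem_of_add_mem_of_sq_sub_sq_mem S (by positivity) hadd ?_
    rw [hu_sq, hv_sq]
    exact sub_mem (intCast_mem S _) (intCast_mem S _)
  by_contra hint
  exact irrational_nrt_of_notint_nrt 2 _ hu_sq hint two_pos hrat

lemma exists_pythagoreanTriple (h : IsEquablePair u v) :
    ∃ a b m : ℤ, PythagoreanTriple a b m ∧ |u 0| = a ∧ |u 1| = b ∧ ‖u‖ = m := by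
  obtain ⟨a, ha⟩ := h.lattice_left 0
  obtain ⟨b, hb⟩ := h.lattice_left 1
  obtain ⟨m, hm⟩ := h.exists_int_norm_eq
  refine ⟨|a|, |b|, m, ?_, by simp [ha], by simp [hb], hm⟩
  have hsq := EuclideanSpace.real_norm_sq_eq u
  rw [Fin.sum_univ_two, ha, hb, hm] at hsq
  rw [PythagoreanTriple, abs_mul_abs_self, abs_mul_abs_self]
  exact_mod_cast (by linarith : (a : ℝ) * a + b * b = m * m)

theorem mul_mul_mul_nonneg (h : IsEquablePair u v) : 0 ≤ (u 0 * v 0) * (u 1 * v 1) := by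
  -- Otherwise the two terms of the cross product have opposite signs, so the area is
  -- `|u 0| * |v 1| + |u 1| * |v 0|`, which exceeds the perimeter.
  by_contra! hneg
  have hcross : |cross u v| = |u 0| * |v 1| + |u 1| * |v 0| := by
    have hneg' : (u 0 * v 1) * (u 1 * v 0) < 0 := by linarith
    rw [cross, abs_sub_eq_abs_add_abs_of_mul_nonpos hneg'.le, abs_mul, abs_mul]
  obtain ⟨hu0, hv0⟩ := mul_ne_zero_iff.1 (left_ne_zero_of_mul hneg.ne)
  obtain ⟨hu1, hv1⟩ := mul_ne_zero_iff.1 (right_ne_zero_of_mul hneg.ne)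
  obtain ⟨a, b, m, habm, ha, hb, hm⟩ := h.exists_pythagoreanTriple
  obtain ⟨c, d, n, hcdn, hc, hd, hn⟩ := h.symm.exists_pythagoreanTriple
  rw [← abs_pos, ha, Int.cast_pos] at hu0
  rw [← abs_pos, hb, Int.cast_pos] at hu1
  rw [← abs_pos, hc, Int.cast_pos] at hv0
  rw [← abs_pos, hd, Int.cast_pos] at hv1
  have hlt := two_mul_abs_hypotenuses_lt habm hcdn hu0 hu1 hv0 hv1
  have heq : 2 * (m + n) = a * d + b * c := by
    have hreal : 2 * ((m : ℝ) + n) = a * d + b * c := by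
      rw [← hm, ← hn, h.equable, hcross, ha, hb, hc, hd]
    exact_mod_cast hreal
  linarith [le_abs_self m, le_abs_self n]

theorem left_mem_firstQuadrant (h : IsEquablePair u v) (hinner : 0 ≤ inner ℝ u v)
    (hadd : u + v ∈ firstQuadrant) : u ∈ firstQuadrant := by
  have hdot : 0 ≤ u 0 * v 0 + u 1 * v 1 := by
    simpa [PiLp.inner_apply, mul_comm] using hinner
  have hcoord : ∀ j, 0 ≤ u j * v j := Fin.forall_fin_two.2
    ⟨nonneg_of_mul_nonneg_of_add_nonneg h.mul_mul_mul_nonneg hdot,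
      nonneg_of_mul_nonneg_of_add_nonneg (mul_comm (u 0 * v 0) _ ▸ h.mul_mul_mul_nonneg)
        (add_comm (u 0 * v 0) _ ▸ hdot)⟩
  exact mem_firstQuadrant_iff.2 fun j =>
    nonneg_of_mul_nonneg_of_add_nonneg (hcoord j) (mem_firstQuadrant_iff.1 hadd j)

end IsEquablePair

section Parallelogram

variable {P : Fin 4 → Plane}

open scoped Pointwise in
lemma region_eq_vadd_parallelepiped (h : P 1 - P 0 = P 2 - P 3) :
    region P = P 0 +ᵥ parallelepiped ![P 1 - P 0, P 3 - P 0] := by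
  have hP2 : P 0 + (P 1 - P 0 + (P 3 - P 0)) = P 2 := by
    rw [h]
    abel
  rw [← convexHull_eq_parallelepiped, ← convexHull_vadd, region]
  congr 1
  ext x
  simp [Set.vadd_set_insert, hP2, Fin.exists_fin_succ, eq_comm]

lemma area_eq_abs_cross (h : P 1 - P 0 = P 2 - P 3) :
    area P = |cross (P 1 - P 0) (P 3 - P 0)| := by
  rw [area, region_eq_vadd_parallelepiped h, measureReal_def, measure_vadd,
    ← (EuclideanSpace.basisFun (Fin 2) ℝ).addHaar_eq_volume, Measure.addHaar_parallelepiped,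
    ENNReal.toReal_ofReal (abs_nonneg _), Module.Basis.det_apply, Matrix.det_fin_two]
  simp [Module.Basis.toMatrix_apply, cross, mul_comm]

lemma perimeter_eq_two_mul (h : P 1 - P 0 = P 2 - P 3) :
    perimeter P = 2 * (‖P 1 - P 0‖ + ‖P 3 - P 0‖) := by
  have hopp : dist (P 1) (P 2) = ‖P 3 - P 0‖ := by
    rw [dist_eq_norm, sub_eq_sub_iff_sub_eq_sub.1 h, norm_sub_rev]
  rw [perimeter, hopp, dist_eq_norm', dist_eq_norm (P 2), ← h, dist_eq_norm]
  ring

lemma region_map (g : Plane ≃ᵃⁱ[ℝ] Plane) (P : Fin 4 → Plane) :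
    region (fun i => g (P i)) = g '' region P := by
  rw [region, region, Set.range_comp' g P]
  exact (g.toAffineEquiv.toAffineMap.image_convexHull _).symm

lemma area_map (g : Plane ≃ᵃⁱ[ℝ] Plane) (P : Fin 4 → Plane) :
    area (fun i => g (P i)) = area P := by
  rw [area, region_map, measureReal_def, volume_image_isometry g.isometry, area, measureReal_def]

lemma perimeter_map (g : Plane ≃ᵃⁱ[ℝ] Plane) (P : Fin 4 → Plane) :
    perimeter (fun i => g (P i)) = perimeter P := by
  simp only [perimeter, g.dist_map]

lemma IsParallelogram.map (h : IsParallelogram P) (g : Plane ≃ᵃⁱ[ℝ] Plane) :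
    IsParallelogram fun i => g (P i) := by
  refine ⟨?_, ?_⟩
  · have hcomp : g ∘ ![P 0, P 1, P 2] = ![g (P 0), g (P 1), g (P 2)] := by
      funext i
      fin_cases i <;> rfl
    exact hcomp ▸ g.toAffineEquiv.affineIndependent_iff.2 h.1
  · have hlin := congrArg g.linearIsometryEquiv h.2
    simpa only [← vsub_eq_sub, g.map_vsub] using hlin

lemma IsParallelogram.rotate (h : IsParallelogram P) : IsParallelogram fun i => P (i + 1) := by
  refine ⟨?_, ?_⟩
  · have hnoncol := affineIndependent_iff_not_collinear_set.1 h.1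
    refine affineIndependent_iff_not_collinear_set.2 fun hcol => hnoncol ?_
    change Collinear ℝ {P 1, P 2, P 3} at hcol
    have hP0 : P 0 ∈ affineSpan ℝ {P 1, P 2, P 3} := by
      have hspan := AffineSubspace.smul_vsub_vadd_mem (affineSpan ℝ {P 1, P 2, P 3}) (1 : ℝ)
        (mem_affineSpan ℝ (by simp : P 3 ∈ _)) (mem_affineSpan ℝ (by simp : P 2 ∈ _))
        (mem_affineSpan ℝ (by simp : P 1 ∈ _))
      convert hspan using 1
      rw [one_smul, vsub_eq_sub, vadd_eq_add, ← neg_sub, ← h.2]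
      abel
    exact ((collinear_insert_iff_of_mem_affineSpan hP0).2 hcol).subset (by grind)
  · change P 2 - P 1 = P 3 - P 0
    rw [← neg_sub, sub_eq_sub_iff_sub_eq_sub.1 h.2, neg_sub]

end Parallelogram

namespace IsLEP

variable {P : Fin 4 → Plane}

lemma isEquablePair (hP : IsLEP P) : IsEquablePair (P 1 - P 0) (P 3 - P 0) where
  lattice_left := (hP.lattice 1).sub (hP.lattice 0)
  lattice_right := (hP.lattice 3).sub (hP.lattice 0)
  equable := by
    rw [← perimeter_eq_two_mul hP.parallelogram.2, hP.equable,
      area_eq_abs_cross hP.parallelogram.2]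

lemma map (hP : IsLEP P) {g : Plane ≃ᵃⁱ[ℝ] Plane} (hg : PreservesLattice g) :
    IsLEP fun i => g (P i) where
  parallelogram := hP.parallelogram.map g
  lattice i := hg (hP.lattice i)
  equable := by rw [perimeter_map, area_map, hP.equable]

lemma rotate (hP : IsLEP P) : IsLEP fun i => P (i + 1) where
  parallelogram := hP.parallelogram.rotate
  lattice i := hP.lattice (i + 1)
  equable := by
    have hregion : region (fun i => P (i + 1)) = region P :=
      congrArg (convexHull ℝ) ((Equiv.addRight (1 : Fin 4)).surjective.range_comp P)
    have hperimeter : perimeter (fun i => P (i + 1)) = perimeter P := by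
      change dist (P 1) (P 2) + dist (P 2) (P 3) + dist (P 3) (P 0) + dist (P 0) (P 1) = _
      rw [perimeter]
      ring
    rw [hperimeter, hP.equable, area, area, hregion]

theorem mem_firstQuadrant_of_long_diagonal (hP : IsLEP P) (h0 : P 0 = 0)
    (hle : dist (P 1) (P 3) ≤ dist (P 0) (P 2)) (h2 : P 2 ∈ firstQuadrant) (i : Fin 4) :
    P i ∈ firstQuadrant := by
  have hpair : IsEquablePair (P 1) (P 3) := by simpa only [h0, sub_zero] using hP.isEquablePair
  have hadd : P 1 + P 3 = P 2 := by
    rw [← eq_sub_iff_add_eq, ← hP.parallelogram.2, h0, sub_zero]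
  have hinner : 0 ≤ inner ℝ (P 1) (P 3) := by
    rw [inner_nonneg_iff_norm_sub_le_norm_add, hadd, ← dist_eq_norm]
    simpa only [h0, dist_zero_left] using hle
  fin_cases i
  · simp [h0, firstQuadrant]
  · exact hpair.left_mem_firstQuadrant hinner (hadd ▸ h2)
  · exact h2
  · exact hpair.symm.left_mem_firstQuadrant (real_inner_comm (P 1) (P 3) ▸ hinner)
      (add_comm (P 1) (P 3) ▸ hadd ▸ h2)

end IsLEP

lemma exists_motion_eq_zero_and_mem_firstQuadrant {p : Plane} (hp : IsLatticePoint p) (q : Plane) :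
    ∃ g : Plane ≃ᵃⁱ[ℝ] Plane, PreservesLattice g ∧ g p = 0 ∧ g q ∈ firstQuadrant := by
  obtain ⟨e, hew, habs⟩ := exists_linearIsometryEquiv_apply_eq_abs (q - p)
  let g := (AffineIsometryEquiv.constVAdd ℝ Plane (-p)).trans e.toAffineIsometryEquiv
  have hg : ∀ x, g x = e (x - p) := fun x => by simp [g, sub_eq_neg_add]
  refine ⟨g, fun x hx => ?_, by rw [hg, sub_self, map_zero], ?_⟩
  · rw [hg]
    exact (hx.sub hp).of_abs_eq (habs _)
  · rw [hg, mem_firstQuadrant_iff]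
    exact fun j => (abs_nonneg _).trans_eq (hew j).symm

namespace IsLEP

variable {P : Fin 4 → Plane}

lemma exists_motion_mem_firstQuadrant_of_long_diagonal (hP : IsLEP P)
    (hle : dist (P 1) (P 3) ≤ dist (P 0) (P 2)) :
    ∃ g : Plane ≃ᵃⁱ[ℝ] Plane, PreservesLattice g ∧
      g (P 0) = 0 ∧ ∀ i, g (P i) ∈ firstQuadrant := by
  obtain ⟨g, hlattice, h0, h2⟩ := exists_motion_eq_zero_and_mem_firstQuadrant (hP.lattice 0) (P 2)
  refine ⟨g, hlattice, h0, (hP.map hlattice).mem_firstQuadrant_of_long_diagonal h0 ?_ h2⟩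
  simpa only [g.dist_map] using hle

theorem exists_motion_mem_firstQuadrant (hP : IsLEP P) :
    ∃ g : Plane ≃ᵃⁱ[ℝ] Plane, PreservesLattice g ∧
      (∃ i, g (P i) = 0) ∧ ∀ i, g (P i) ∈ firstQuadrant := by
  rcases le_total (dist (P 1) (P 3)) (dist (P 0) (P 2)) with hle | hle
  · obtain ⟨g, hlattice, h0, hmem⟩ := hP.exists_motion_mem_firstQuadrant_of_long_diagonal hle
    exact ⟨g, hlattice, ⟨0, h0⟩, hmem⟩
  · obtain ⟨g, hlattice, h1, hmem⟩ :=
      hP.rotate.exists_motion_mem_firstQuadrant_of_long_diagonal (by rwa [dist_comm] at hle)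
    exact ⟨g, hlattice, ⟨1, h1⟩, fun i => by simpa only [sub_add_cancel] using hmem (i - 1)⟩

end IsLEP

theorem mainTheorem11 :
    (∀ P : Fin 4 → Plane, IsLEP P → P 0 = 0 →
      dist (P 1) (P 3) ≤ dist (P 0) (P 2) →
      segment ℝ (P 0) (P 2) ⊆ firstQuadrant →
      ∀ i, P i ∈ firstQuadrant) ∧
    (∀ P : Fin 4 → Plane, IsLEP P →
      ∃ g : Plane ≃ᵃⁱ[ℝ] Plane,
        IsLEP (fun i => g (P i)) ∧
        region (fun i => g (P i)) ⊆ firstQuadrant ∧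
        ∃ i, g (P i) = 0) := by
  refine ⟨fun P hP h0 hle hseg => ?_, fun P hP => ?_⟩
  · exact hP.mem_firstQuadrant_of_long_diagonal h0 hle (hseg (right_mem_segment ℝ _ _))
  · obtain ⟨g, hlattice, horigin, hmem⟩ := hP.exists_motion_mem_firstQuadrant
    have hregion : region (fun i => g (P i)) ⊆ firstQuadrant :=
      convexHull_min (Set.range_subset_iff.2 hmem) convex_firstQuadrant
    exact ⟨g, hP.map hlattice, hregion, horigin⟩
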